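/- Let $n\ge 2$, let $\mathbb B^n=\{u\in\mathbb R^n : |u|<1\}$ be the open unit ball of Euclidean space $\mathbb R^n$, with inner product $(u,v)$ and norm $|u|=\sqrt{(u,u)}$, and let $$u\oplus v=\frac1{1+(u,v)}\left(u+\sqrt{1-|u|^2}\, v+\frac{(u,v)}{1+\sqrt{1-|u|^2}}\, u\right)\qquad(u,v\in\mathbb B^n)$$ be the operation of the Einstein gyrogroup $(\mathbb B^n,\oplus)$. An automorphism of $(\mathbb B^n,\oplus)$ is a bijective map $f:\mathbb B^n\to\mathbb B^n$ such that $f(u\oplus v)=f(u)\oplus f(v)$ for all $u,v\in\mathbb B^n$ (no continuity is assumed). Then the automorphisms of $(\mathbb B^n,\oplus)$ are precisely the restrictions to $\mathbb B^n$ of the orthogonal transformations of $\mathbb R^n$. -/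

import Mathlib

noncomputable section

/-- The open unit ball `B^n` of Euclidean space `ℝ^n`. -/
abbrev EinsteinBall (n : ℕ) : Type :=
  Metric.ball (0 : EuclideanSpace ℝ (Fin n)) 1

/-- The relativistic velocity addition formula (speed of light equal to `1`), as a vector of
`ℝ^n`. It is only meant for `u`, `v` in the open unit ball, where no denominator vanishes. -/
def velocityAdd {n : ℕ} (u v : EuclideanSpace ℝ (Fin n)) : EuclideanSpace ℝ (Fin n) :=
  (1 / (1 + inner ℝ u v)) •
    (u + Real.sqrt (1 - ‖u‖ ^ 2) • v + (inner ℝ u v / (1 + Real.sqrt (1 - ‖u‖ ^ 2))) • u)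

theorem one_add_inner_pos_of_norm_lt {n : ℕ} {u v : EuclideanSpace ℝ (Fin n)}
    (hu : ‖u‖ < 1) (hv : ‖v‖ < 1) : 0 < 1 + inner ℝ u v := by
  have h := abs_real_inner_le_norm u v
  have h1 : ‖u‖ * ‖v‖ < 1 := by nlinarith [norm_nonneg u, norm_nonneg v]
  linarith [neg_abs_le (inner ℝ u v : ℝ)]

theorem one_sub_norm_velocityAdd_sq {n : ℕ} {u v : EuclideanSpace ℝ (Fin n)}
    (hu : ‖u‖ < 1) (hv : ‖v‖ < 1) :
    1 - ‖velocityAdd u v‖ ^ 2 =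
      (1 - ‖u‖ ^ 2) * (1 - ‖v‖ ^ 2) / (1 + inner ℝ u v) ^ 2 := by
  have hp := one_add_inner_pos_of_norm_lt hu hv
  have hs : Real.sqrt (1 - ‖u‖ ^ 2) ^ 2 = 1 - ‖u‖ ^ 2 :=
    Real.sq_sqrt (by nlinarith [norm_nonneg u])
  have hs0 := Real.sqrt_nonneg (1 - ‖u‖ ^ 2)
  rw [← real_inner_self_eq_norm_sq (velocityAdd u v)]
  unfold velocityAdd
  simp only [inner_smul_left, inner_smul_right, inner_add_left, inner_add_right,
    real_inner_self_eq_norm_sq, real_inner_comm u v, RCLike.conj_to_real]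
  generalize Real.sqrt (1 - ‖u‖ ^ 2) = s at *
  generalize (inner ℝ u v : ℝ) = p at *
  have hu2 : ‖u‖ ^ 2 = 1 - s ^ 2 := by linarith
  have hs1 : (1 + s) ≠ 0 := by positivity
  rw [hu2]
  field_simp
  ring

theorem velocityAdd_mem_ball {n : ℕ} {u v : EuclideanSpace ℝ (Fin n)}
    (hu : u ∈ Metric.ball (0 : EuclideanSpace ℝ (Fin n)) 1)
    (hv : v ∈ Metric.ball (0 : EuclideanSpace ℝ (Fin n)) 1) :
    velocityAdd u v ∈ Metric.ball (0 : EuclideanSpace ℝ (Fin n)) 1 := by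
  rw [mem_ball_zero_iff] at *
  have h := one_sub_norm_velocityAdd_sq hu hv
  have hp := one_add_inner_pos_of_norm_lt hu hv
  have h1 : 0 < 1 - ‖u‖ ^ 2 := by nlinarith [norm_nonneg u]
  have h2 : 0 < 1 - ‖v‖ ^ 2 := by nlinarith [norm_nonneg v]
  have h3 : 0 < (1 - ‖u‖ ^ 2) * (1 - ‖v‖ ^ 2) / (1 + inner ℝ u v) ^ 2 := by positivity
  nlinarith [norm_nonneg (velocityAdd u v)]

/-- The operation of the Einstein gyrogroup: velocity addition on the open unit ball. -/
def einsteinAdd {n : ℕ} (u v : EinsteinBall n) : EinsteinBall n :=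
  ⟨velocityAdd u.1 v.1, velocityAdd_mem_ball u.2 v.2⟩

/-- Endomorphisms of the Einstein gyrogroup; no continuity is required. -/
def IsEinsteinEndomorphism {n : ℕ} (f : EinsteinBall n → EinsteinBall n) : Prop :=
  ∀ u v : EinsteinBall n, f (einsteinAdd u v) = einsteinAdd (f u) (f v)

/-- Automorphisms of the Einstein gyrogroup: bijective endomorphisms. -/
def IsEinsteinAutomorphism {n : ℕ} (f : EinsteinBall n → EinsteinBall n) : Prop :=
  IsEinsteinEndomorphism f ∧ Function.Bijective f

/-- The restriction to the open unit ball of an orthogonal transformation of `ℝ^n`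
(a linear isometric automorphism). -/
def orthogonalRestrict {n : ℕ}
    (A : EuclideanSpace ℝ (Fin n) ≃ₗᵢ[ℝ] EuclideanSpace ℝ (Fin n)) :
    EinsteinBall n → EinsteinBall n :=
  fun u => ⟨A u.1, by
    have h := u.2
    rw [mem_ball_zero_iff] at h ⊢
    rwa [A.norm_map]⟩

end

/-! Write γ for the Lorentz factor; everything rests on γ(u ⊕ v) = γ(u) γ(v) (1 + (u,v)). Orthogonal
maps are clearly automorphisms. Conversely, x ⊕ y and y ⊕ x have equal norms, and any two nearby
points of a sphere about 0 are such a pair. So |f| is locally constant on spheres, which are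
connected for n ≥ 2: γ(f u) = G(γ(u)) (`norm_map_eq_of_norm_eq`). Hence f preserves orthogonality,
and G is multiplicative and commutes with x ↦ 2x² - 1; these equations force G = id or G = 1, and
injectivity excludes the latter (`norm_map`). The γ identity then gives preservation of inner
products, with no continuity assumed. -/

/-- The Lorentz factor of a velocity. -/
noncomputable def lorentzFactor {n : ℕ} (u : EuclideanSpace ℝ (Fin n)) : ℝ :=
  (Real.sqrt (1 - ‖u‖ ^ 2))⁻¹

/-! ### Lorentz factors and velocity addition. -/

section LorentzFactor

variable {n : ℕ} {u v : EuclideanSpace ℝ (Fin n)}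

theorem one_sub_norm_sq_pos (hu : ‖u‖ < 1) : 0 < 1 - ‖u‖ ^ 2 := by
  nlinarith [norm_nonneg u]

theorem lorentzFactor_sq_mul (hu : ‖u‖ < 1) : lorentzFactor u ^ 2 * (1 - ‖u‖ ^ 2) = 1 := by
  have h := one_sub_norm_sq_pos hu
  rw [lorentzFactor, inv_pow, Real.sq_sqrt h.le, inv_mul_cancel₀ h.ne']

theorem lorentzFactor_pos (hu : ‖u‖ < 1) : 0 < lorentzFactor u :=
  inv_pos.2 (Real.sqrt_pos.2 (one_sub_norm_sq_pos hu))

theorem one_le_lorentzFactor (hu : ‖u‖ < 1) : 1 ≤ lorentzFactor u := by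
  have h1 := lorentzFactor_sq_mul hu
  have h2 := lorentzFactor_pos hu
  nlinarith [mul_nonneg (sq_nonneg (lorentzFactor u)) (sq_nonneg ‖u‖)]

theorem norm_eq_of_lorentzFactor_eq (hu : ‖u‖ < 1) (hv : ‖v‖ < 1)
    (h : lorentzFactor u = lorentzFactor v) : ‖u‖ = ‖v‖ := by
  have h1 := lorentzFactor_sq_mul hu
  have h2 := lorentzFactor_sq_mul hv
  rw [h] at h1
  have h3 : lorentzFactor v ^ 2 ≠ 0 := (pow_pos (lorentzFactor_pos hv) 2).ne'
  have h4 : 1 - ‖u‖ ^ 2 = 1 - ‖v‖ ^ 2 := mul_left_cancel₀ h3 (h1.trans h2.symm)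
  exact (sq_eq_sq₀ (norm_nonneg u) (norm_nonneg v)).1 (by linarith)

theorem lorentzFactor_velocityAdd (hu : ‖u‖ < 1) (hv : ‖v‖ < 1) :
    lorentzFactor (velocityAdd u v) =
      lorentzFactor u * lorentzFactor v * (1 + inner ℝ u v) := by
  have hp := one_add_inner_pos_of_norm_lt hu hv
  have h1 := one_sub_norm_sq_pos hu
  rw [lorentzFactor, one_sub_norm_velocityAdd_sq hu hv, Real.sqrt_div' _ (by positivity),
    Real.sqrt_mul h1.le, Real.sqrt_sq hp.le, lorentzFactor, lorentzFactor, inv_div, div_eq_mul_inv,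
    mul_inv]
  ring

theorem exists_lorentzFactor_eq {x : ℝ} (hx : 1 ≤ x) {e : EuclideanSpace ℝ (Fin n)}
    (he : ‖e‖ = 1) : ∃ r : ℝ, ‖r • e‖ < 1 ∧ lorentzFactor (r • e) = x := by
  have hx0 : 0 < x := by linarith
  have h1 : (x ^ 2)⁻¹ ≤ 1 := inv_le_one_of_one_le₀ (by nlinarith)
  have h2 : 0 < (x ^ 2)⁻¹ := by positivity
  have h3 : ‖Real.sqrt (1 - (x ^ 2)⁻¹) • e‖ = Real.sqrt (1 - (x ^ 2)⁻¹) := by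
    rw [norm_smul, he, mul_one, Real.norm_of_nonneg (Real.sqrt_nonneg _)]
  refine ⟨Real.sqrt (1 - (x ^ 2)⁻¹), ?_, ?_⟩
  · rw [h3, Real.sqrt_lt' one_pos]
    linarith
  · rw [lorentzFactor, h3, Real.sq_sqrt (by linarith), sub_sub_cancel, Real.sqrt_inv,
      Real.sqrt_sq hx0.le, inv_inv]

/-- The norm identity makes |u + v|² equal to the Gram determinant of u and v, which is also that of
u and u + v, hence at most |u|² |u + v|². -/
theorem eq_neg_of_velocityAdd_eq_zero (hu : ‖u‖ < 1) (hv : ‖v‖ < 1)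
    (h : velocityAdd u v = 0) : u = -v := by
  have hp := one_add_inner_pos_of_norm_lt hu hv
  have h1 := one_sub_norm_velocityAdd_sq hu hv
  rw [h, norm_zero, eq_div_iff (by positivity)] at h1
  have h2 := norm_add_sq_real u v
  have h3 := real_inner_mul_inner_self_le u (u + v)
  have h4 : inner ℝ u (u + v) = ‖u‖ ^ 2 + inner ℝ u v := by
    rw [inner_add_right, real_inner_self_eq_norm_sq]
  rw [real_inner_self_eq_norm_sq, real_inner_self_eq_norm_sq, h4] at h3
  have h5 := one_sub_norm_sq_pos hu
  have h6 : ‖u + v‖ ^ 2 * (1 - ‖u‖ ^ 2) ≤ 0 := by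
    rw [h2] at h3 ⊢
    nlinarith
  have h7 : ‖u + v‖ ^ 2 = 0 := by nlinarith [sq_nonneg ‖u + v‖]
  exact eq_neg_of_add_eq_zero_left (norm_eq_zero.1 (pow_eq_zero_iff two_ne_zero |>.1 h7))

theorem velocityAdd_neg_self (hv : ‖v‖ < 1) : velocityAdd (-v) v = 0 := by
  have h := one_sub_norm_velocityAdd_sq (u := -v) (by rwa [norm_neg]) hv
  have h1 := one_sub_norm_sq_pos hv
  rw [norm_neg, inner_neg_left, real_inner_self_eq_norm_sq, ← sub_eq_add_neg, ← sq,
    div_self (by positivity)] at h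
  exact norm_eq_zero.1 (pow_eq_zero_iff two_ne_zero |>.1 (by linarith))

theorem velocityAdd_of_inner_eq_zero (h : inner ℝ u v = 0) :
    velocityAdd u v = u + Real.sqrt (1 - ‖u‖ ^ 2) • v := by
  simp [velocityAdd, h]

theorem norm_velocityAdd_comm (hu : ‖u‖ < 1) (hv : ‖v‖ < 1) :
    ‖velocityAdd u v‖ = ‖velocityAdd v u‖ := by
  have hb {w : EuclideanSpace ℝ (Fin n)} (hw : ‖w‖ < 1) : w ∈ Metric.ball 0 1 :=
    mem_ball_zero_iff.2 hw
  refine norm_eq_of_lorentzFactor_eq (mem_ball_zero_iff.1 (velocityAdd_mem_ball (hb hu) (hb hv)))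
    (mem_ball_zero_iff.1 (velocityAdd_mem_ball (hb hv) (hb hu))) ?_
  rw [lorentzFactor_velocityAdd hu hv, lorentzFactor_velocityAdd hv hu, real_inner_comm,
    mul_comm (lorentzFactor u)]

/-- Two vectors of equal norm forming a small enough angle are the two sums of a pair of
orthogonal velocities. -/
theorem exists_velocityAdd_eq_and_comm {a b : EuclideanSpace ℝ (Fin n)} {P : ℝ} (hP0 : 0 < P)
    (hP1 : P < 1) (ha : ‖a‖ ^ 2 = 1 - P ^ 2) (hb : ‖b‖ ^ 2 = 1 - P ^ 2)
    (hab : 2 * Real.sqrt P * (1 - P) ≤ inner ℝ a b) :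
    ∃ x y : EuclideanSpace ℝ (Fin n), ‖x‖ < 1 ∧ ‖y‖ < 1 ∧
      velocityAdd x y = a ∧ velocityAdd y x = b := by
  have hq := Real.sqrt_pos.2 hP0
  have hq2 := Real.sq_sqrt hP0.le
  obtain ⟨k, hk⟩ : ∃ k : ℝ, inner ℝ a b = k * (1 - P) :=
    ⟨inner ℝ a b / (1 - P), by rw [div_mul_cancel₀ _ (by linarith)]⟩
  have hk2 : 2 * Real.sqrt P ≤ k := by
    rw [hk] at hab
    exact le_of_mul_le_mul_right hab (by linarith)
  have hdisc : 0 ≤ k ^ 2 - 4 * P := by nlinarith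
  have hd0 := Real.sqrt_nonneg (k ^ 2 - 4 * P)
  have hd2 := Real.sq_sqrt hdisc
  have hdk : Real.sqrt (k ^ 2 - 4 * P) < k := by
    rw [Real.sqrt_lt' (by linarith)]
    linarith
  -- For x ⊥ y with S = √(1-|x|²), T = √(1-|y|²), the sums are a = x + S y and b = y + T x, and
  -- (a,b) = (S + T)(1 - S T). So S, T are the roots of t² - k t + P, and inverting the linear
  -- system gives x = (a - S b)/(1 - P), y = (b - T a)/(1 - P).
  obtain ⟨S, T, hS, hT, hST, hsum⟩ : ∃ S T : ℝ, 0 < S ∧ 0 < T ∧ S * T = P ∧ S + T = k :=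
    ⟨(k + Real.sqrt (k ^ 2 - 4 * P)) / 2, (k - Real.sqrt (k ^ 2 - 4 * P)) / 2, by linarith,
      by linarith, by nlinarith, by ring⟩
  have hne : (1 - P) ≠ 0 := by linarith
  have hba : inner ℝ b a = k * (1 - P) := by rw [real_inner_comm, hk]
  have key : ∀ {a b : EuclideanSpace ℝ (Fin n)} {S T : ℝ}, 0 < S → S * T = P → S + T = k →
      ‖a‖ ^ 2 = 1 - P ^ 2 → ‖b‖ ^ 2 = 1 - P ^ 2 → inner ℝ a b = k * (1 - P) →
      1 - ‖(1 - P)⁻¹ • (a - S • b)‖ ^ 2 = S ^ 2 := by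
    intro a b S T hS hST hsum ha hb hk
    rw [norm_smul, mul_pow, norm_sub_sq_real, norm_smul, inner_smul_right, mul_pow, ha, hb, hk,
      Real.norm_eq_abs, Real.norm_eq_abs, sq_abs, sq_abs, ← hsum]
    field_simp
    linear_combination (2 - 2 * P) * hST
  have horth : inner ℝ ((1 - P)⁻¹ • (a - S • b)) ((1 - P)⁻¹ • (b - T • a)) = 0 := by
    simp only [inner_smul_left, inner_smul_right, inner_sub_left, inner_sub_right,
      real_inner_self_eq_norm_sq, ha, hb, hk, hba, RCLike.conj_to_real]
    rw [← hsum]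
    field_simp
    linear_combination (S + T) * (1 - P) * hST
  have hx := key hS hST hsum ha hb hk
  have hy := key hT (by rw [mul_comm, hST]) (by rw [add_comm, hsum]) hb ha hba
  refine ⟨_, _, ?_, ?_, (velocityAdd_of_inner_eq_zero horth).trans ?_,
    (velocityAdd_of_inner_eq_zero ((real_inner_comm _ _).trans horth)).trans ?_⟩
  · rw [← abs_norm, ← sq_lt_one_iff_abs_lt_one]
    nlinarith
  · rw [← abs_norm, ← sq_lt_one_iff_abs_lt_one]
    nlinarith
  · rw [hx, Real.sqrt_sq hS.le, ← hST]
    rw [← hST] at hne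
    match_scalars <;> field_simp <;> ring
  · rw [hy, Real.sqrt_sq hT.le, ← hST]
    rw [← hST] at hne
    match_scalars <;> field_simp <;> ring

end LorentzFactor

/-! ### Functional equations on the reals. -/

/-- A nonnegative additive function on the nonnegative reals is linear. -/
theorem eq_mul_of_additive_of_nonneg {h : ℝ → ℝ} (h0 : ∀ w, 0 ≤ w → 0 ≤ h w)
    (hadd : ∀ x y, 0 ≤ x → 0 ≤ y → h (x + y) = h x + h y) {w : ℝ} (hw : 0 ≤ w) :
    h w = h 1 * w := by
  have hmono : ∀ x y, 0 ≤ x → x ≤ y → h x ≤ h y := fun x y hx hxy => by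
    have := hadd x (y - x) hx (by linarith)
    rw [add_sub_cancel] at this
    linarith [h0 (y - x) (by linarith)]
  have hz : h 0 = 0 := by
    have := hadd 0 0 le_rfl le_rfl
    rw [add_zero] at this
    linarith
  have hnat : ∀ (m : ℕ) x, 0 ≤ x → h (m * x) = m * h x := fun m x hx => by
    induction m with
    | zero => simp [hz]
    | succ m ih =>
      push_cast
      rw [add_mul, one_mul, hadd _ _ (by positivity) hx, ih]
      ring
  -- By monotonicity, N h(w) and N w h(1) both lie between ⌊N w⌋ h(1) and (⌊N w⌋ + 1) h(1).
  have hbound : ∀ N : ℕ, N * |h w - h 1 * w| ≤ h 1 := fun N => by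
    have hNw : 0 ≤ N * w := by positivity
    have l := Nat.floor_le hNw
    have r := (Nat.lt_floor_add_one (N * w)).le
    have l' := hmono _ _ (by positivity) l
    have r' := hmono _ _ hNw r
    have e1 := hnat ⌊N * w⌋₊ 1 zero_le_one
    have e2 := hnat (⌊N * w⌋₊ + 1) 1 zero_le_one
    have e3 := hnat N w hw
    push_cast at e2
    rw [mul_one] at e1 e2
    rw [e1, e3] at l'
    rw [e2, e3] at r'
    have hc := h0 1 zero_le_one
    rw [← Nat.abs_cast, ← abs_mul, abs_le]
    constructor <;> nlinarith
  by_contra hne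
  have hpos : 0 < |h w - h 1 * w| := abs_pos.2 (sub_ne_zero.2 hne)
  obtain ⟨N, hN⟩ := exists_nat_gt (h 1 / |h w - h 1 * w|)
  rw [div_lt_iff₀ hpos] at hN
  linarith [hbound N]

/-- Putting x = √z in the doubling rule gives G(2z - 1) = 2 G(z) - 1; rescaling by multiplicativity
turns this into Jensen's equation. Since G ≥ 1, G is affine, and G(4) = G(2)² leaves slope 0 or 1.
-/
theorem eq_self_of_multiplicative_of_double {G : ℝ → ℝ} (h1 : ∀ x, 1 ≤ x → 1 ≤ G x)
    (hmul : ∀ x y, 1 ≤ x → 1 ≤ y → G (x * y) = G x * G y)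
    (hdbl : ∀ x, 1 ≤ x → G (2 * x ^ 2 - 1) = 2 * G x ^ 2 - 1)
    (hne : ∃ x, 1 ≤ x ∧ G x ≠ 1) {x : ℝ} (hx : 1 ≤ x) : G x = x := by
  have hG1 : G 1 = 1 := by
    have := hmul 1 1 le_rfl le_rfl
    rw [one_mul] at this
    nlinarith [h1 1 le_rfl]
  have hmid : ∀ z, 1 ≤ z → G (2 * z - 1) = 2 * G z - 1 := fun z hz => by
    have hs : 1 ≤ Real.sqrt z := Real.one_le_sqrt.2 hz
    have e1 := hdbl _ hs
    have e2 := hmul _ _ hs hs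
    rw [Real.sq_sqrt (by linarith)] at e1
    rw [Real.mul_self_sqrt (by linarith)] at e2
    rw [e1, e2]
    ring
  have hjen' : ∀ a b, 1 ≤ b → b ≤ a → 2 * G ((a + b) / 2) = G a + G b := fun a b hb hab => by
    have hb0 : 0 < b := by linarith
    have hr : 1 ≤ a / b := (one_le_div hb0).2 hab
    have e1 := hmid ((a / b + 1) / 2) (by linarith)
    have e2 := hmul b ((a / b + 1) / 2) hb (by linarith)
    have e3 := hmul b (a / b) hb hr
    rw [show 2 * ((a / b + 1) / 2) - 1 = a / b by ring] at e1
    rw [show b * ((a / b + 1) / 2) = (a + b) / 2 by field_simp] at e2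
    rw [mul_div_cancel₀ _ hb0.ne'] at e3
    rw [e2, e3, e1]
    ring
  have hjen : ∀ a b, 1 ≤ a → 1 ≤ b → 2 * G ((a + b) / 2) = G a + G b := fun a b ha hb => by
    rcases le_total b a with h | h
    · exact hjen' a b hb h
    · rw [add_comm a, add_comm (G a)]
      exact hjen' b a ha h
  have hlin : ∀ w, 0 ≤ w → G (1 + w) - 1 = (G (1 + 1) - 1) * w := fun w hw =>
    eq_mul_of_additive_of_nonneg (h := fun w => G (1 + w) - 1)
      (fun w hw => sub_nonneg.2 (h1 _ (by linarith)))
      (fun x y hx hy => by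
        have e1 := hjen (1 + 2 * x) (1 + 2 * y) (by linarith) (by linarith)
        have e2 := hmid (1 + x) (by linarith)
        have e3 := hmid (1 + y) (by linarith)
        rw [show (1 + 2 * x + (1 + 2 * y)) / 2 = 1 + (x + y) by ring] at e1
        rw [show 2 * (1 + x) - 1 = 1 + 2 * x by ring] at e2
        rw [show 2 * (1 + y) - 1 = 1 + 2 * y by ring] at e3
        linarith) hw
  obtain ⟨c, hc⟩ : ∃ c, c = G (1 + 1) - 1 := ⟨_, rfl⟩
  rw [← hc] at hlin
  have haff : ∀ x, 1 ≤ x → G x = 1 + c * (x - 1) := fun x hx => by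
    have := hlin (x - 1) (by linarith)
    rw [add_sub_cancel] at this
    linarith
  have hc01 : c * (c - 1) = 0 := by
    have := hmul 2 2 one_le_two one_le_two
    rw [haff _ one_le_two, haff _ (by norm_num)] at this
    linarith
  rcases mul_eq_zero.1 hc01 with h | h
  · obtain ⟨y, hy, hGy⟩ := hne
    exact absurd (by rw [haff y hy, h]; ring) hGy
  · rw [haff x hx, sub_eq_zero.1 h]
    ring

/-! ### Endomorphisms preserve norms and inner products. -/

namespace IsEinsteinEndomorphism

variable {n : ℕ} {f : EinsteinBall n → EinsteinBall n}

theorem norm_lt (u : EinsteinBall n) : ‖u.1‖ < 1 := mem_ball_zero_iff.1 u.2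

theorem lorentzFactor_map_einsteinAdd (hf : IsEinsteinEndomorphism f) (u v : EinsteinBall n) :
    lorentzFactor (f (einsteinAdd u v)).1 =
      lorentzFactor (f u).1 * lorentzFactor (f v).1 * (1 + inner ℝ (f u).1 (f v).1) := by
  rw [hf u v]
  exact lorentzFactor_velocityAdd (norm_lt _) (norm_lt _)

theorem norm_map_eq_of_norm_eq (hn : 2 ≤ n) (hf : IsEinsteinEndomorphism f)
    {u v : EinsteinBall n} (h : ‖u.1‖ = ‖v.1‖) : ‖(f u).1‖ = ‖(f v).1‖ := by
  rcases (norm_nonneg u.1).eq_or_lt with h0 | h0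
  · have : u = v := Subtype.ext (by
      rw [norm_eq_zero.1 h0.symm, norm_eq_zero.1 (h.symm.trans h0.symm)])
    rw [this]
  have hu1 := norm_lt u
  have hrank : 1 < Module.rank ℝ (EuclideanSpace ℝ (Fin n)) := by
    rw [← Module.finrank_eq_rank, finrank_euclideanSpace_fin]
    exact_mod_cast hn
  have hconn : PreconnectedSpace (Metric.sphere (0 : EuclideanSpace ℝ (Fin n)) ‖u.1‖) :=
    isPreconnected_iff_preconnectedSpace.1 (isPreconnected_sphere hrank 0 _)
  have hmem (a : Metric.sphere (0 : EuclideanSpace ℝ (Fin n)) ‖u.1‖) :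
      a.1 ∈ Metric.ball (0 : EuclideanSpace ℝ (Fin n)) 1 := by
    rw [mem_ball_zero_iff, mem_sphere_zero_iff_norm.1 a.2]
    exact hu1
  have hpos := one_sub_norm_sq_pos hu1
  obtain ⟨P, hP⟩ : ∃ P, P = Real.sqrt (1 - ‖u.1‖ ^ 2) := ⟨_, rfl⟩
  have hP0 : 0 < P := hP ▸ Real.sqrt_pos.2 hpos
  have hPsq : ‖u.1‖ ^ 2 = 1 - P ^ 2 := by
    rw [hP, Real.sq_sqrt hpos.le]
    ring
  have hP1 : P < 1 := by nlinarith
  have hsq := Real.sq_sqrt hP0.le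
  have hs1 : Real.sqrt P < 1 := by
    rw [Real.sqrt_lt' one_pos]
    linarith
  have hloc : IsLocallyConstant
      (fun a : Metric.sphere (0 : EuclideanSpace ℝ (Fin n)) ‖u.1‖ => ‖(f ⟨a.1, hmem a⟩).1‖) := by
    rw [IsLocallyConstant.iff_eventually_eq]
    intro a
    have hcont : Continuous (fun b : Metric.sphere (0 : EuclideanSpace ℝ (Fin n)) ‖u.1‖ =>
        (inner ℝ b.1 a.1 : ℝ)) := by fun_prop
    -- The margin is (1 - P)(1 - √P)² > 0, so the angle condition is open around a.
    have hlt : 2 * Real.sqrt P * (1 - P) < inner ℝ a.1 a.1 := by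
      rw [real_inner_self_eq_norm_sq, mem_sphere_zero_iff_norm.1 a.2, hPsq]
      nlinarith [mul_pos (sub_pos.2 hP1) (pow_pos (sub_pos.2 hs1) 2)]
    filter_upwards [hcont.continuousAt.eventually (lt_mem_nhds hlt)] with b hb
    obtain ⟨x, y, hx, hy, hxy, hyx⟩ := exists_velocityAdd_eq_and_comm hP0 hP1
      (a := b.1) (b := a.1) (by rw [mem_sphere_zero_iff_norm.1 b.2, hPsq])
      (by rw [mem_sphere_zero_iff_norm.1 a.2, hPsq]) hb.le
    have e1 := hf ⟨x, mem_ball_zero_iff.2 hx⟩ ⟨y, mem_ball_zero_iff.2 hy⟩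
    have e2 := hf ⟨y, mem_ball_zero_iff.2 hy⟩ ⟨x, mem_ball_zero_iff.2 hx⟩
    simp only [einsteinAdd, hxy, hyx] at e1 e2
    rw [e1, e2]
    exact norm_velocityAdd_comm (norm_lt _) (norm_lt _)
  exact hloc.apply_eq_of_preconnectedSpace ⟨u.1, mem_sphere_zero_iff_norm.2 rfl⟩
    ⟨v.1, mem_sphere_zero_iff_norm.2 h.symm⟩

theorem map_eq_zero (hf : IsEinsteinEndomorphism f) {u : EinsteinBall n} (h : u.1 = 0) :
    (f u).1 = 0 := by
  have hu : einsteinAdd u u = u := Subtype.ext (by simp [einsteinAdd, velocityAdd, h])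
  have h1 := hf.lorentzFactor_map_einsteinAdd u u
  rw [hu, real_inner_self_eq_norm_sq, mul_assoc] at h1
  have h2 := one_le_lorentzFactor (norm_lt (f u))
  have h3 : 1 = lorentzFactor (f u).1 * (1 + ‖(f u).1‖ ^ 2) :=
    mul_left_cancel₀ (lorentzFactor_pos (norm_lt (f u))).ne' (by rw [mul_one]; exact h1)
  exact norm_eq_zero.1 (pow_eq_zero_iff two_ne_zero |>.1
    (by nlinarith [sq_nonneg ‖(f u).1‖]))

theorem map_neg (hf : IsEinsteinEndomorphism f) {u v : EinsteinBall n} (h : u.1 = -v.1) :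
    (f u).1 = -(f v).1 := by
  have h0 : (einsteinAdd u v).1 = 0 := by
    change velocityAdd u.1 v.1 = 0
    rw [h]
    exact velocityAdd_neg_self (norm_lt v)
  have h1 := hf.map_eq_zero h0
  rw [hf u v] at h1
  exact eq_neg_of_velocityAdd_eq_zero (norm_lt _) (norm_lt _) h1

/-- When u ⊥ v, the sums u ⊕ v and (-u) ⊕ v have equal norms, hence so do their images; comparing
Lorentz factors gives 1 + (f u, f v) = 1 - (f u, f v). -/
theorem inner_map_eq_zero (hn : 2 ≤ n) (hf : IsEinsteinEndomorphism f) {u v : EinsteinBall n}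
    (h : inner ℝ u.1 v.1 = 0) : inner ℝ (f u).1 (f v).1 = 0 := by
  obtain ⟨w, hw⟩ : ∃ w : EinsteinBall n, w.1 = -u.1 :=
    ⟨⟨-u.1, by rw [mem_ball_zero_iff, norm_neg]; exact norm_lt u⟩, rfl⟩
  have h1 : ‖(einsteinAdd u v).1‖ = ‖(einsteinAdd w v).1‖ := by
    refine norm_eq_of_lorentzFactor_eq (norm_lt _) (norm_lt _) ?_
    rw [einsteinAdd, einsteinAdd, lorentzFactor_velocityAdd (norm_lt _) (norm_lt _),
      lorentzFactor_velocityAdd (norm_lt _) (norm_lt _), hw, inner_neg_left, h, neg_zero,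
      lorentzFactor, lorentzFactor, lorentzFactor, norm_neg]
  have h2 := hf.lorentzFactor_map_einsteinAdd u v
  have h3 := hf.lorentzFactor_map_einsteinAdd w v
  have h4 : lorentzFactor (f w).1 = lorentzFactor (f u).1 := by
    rw [hf.map_neg hw, lorentzFactor, lorentzFactor, norm_neg]
  rw [lorentzFactor, ← hf.norm_map_eq_of_norm_eq hn h1, ← lorentzFactor, h2, h4, hf.map_neg hw,
    inner_neg_left] at h3
  have h5 := mul_left_cancel₀ (mul_pos (lorentzFactor_pos (norm_lt (f u)))
    (lorentzFactor_pos (norm_lt (f v)))).ne' h3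
  linarith

theorem norm_map (hn : 2 ≤ n) (hf : IsEinsteinEndomorphism f) (hinj : Function.Injective f)
    (u : EinsteinBall n) : ‖(f u).1‖ = ‖u.1‖ := by
  obtain ⟨i, hi⟩ : ∃ i : Fin n, i = ⟨0, by omega⟩ := ⟨_, rfl⟩
  obtain ⟨j, hj⟩ : ∃ j : Fin n, j = ⟨1, by omega⟩ := ⟨_, rfl⟩
  have hij : i ≠ j := by simp [hi, hj]
  have he (k : Fin n) : ‖EuclideanSpace.single k (1 : ℝ)‖ = 1 := by simp
  have hex (k : Fin n) (x : ℝ) : ∃ r : EinsteinBall n, 1 ≤ x →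
      lorentzFactor r.1 = x ∧ ∃ c : ℝ, r.1 = c • EuclideanSpace.single k (1 : ℝ) := by
    by_cases hx : 1 ≤ x
    · obtain ⟨r, hr, hx'⟩ := exists_lorentzFactor_eq hx (he k)
      exact ⟨⟨_, mem_ball_zero_iff.2 hr⟩, fun _ => ⟨hx', r, rfl⟩⟩
    -- Below 1 no velocity has Lorentz factor x; u is an arbitrary default.
    · exact ⟨u, fun h => absurd h hx⟩
  choose p hp using hex
  have hG (v : EinsteinBall n) :
      lorentzFactor (f v).1 = lorentzFactor (f (p i (lorentzFactor v.1))).1 := by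
    rw [lorentzFactor, lorentzFactor, hf.norm_map_eq_of_norm_eq hn
      (norm_eq_of_lorentzFactor_eq (norm_lt _) (norm_lt _)
        (hp i _ (one_le_lorentzFactor (norm_lt v))).1)]
  have key : lorentzFactor (f (p i (lorentzFactor u.1))).1 = lorentzFactor u.1 := by
    -- Multiplicativity comes from adding velocities along the orthogonal axes i and j, doubling
    -- from adding a velocity to itself.
    refine eq_self_of_multiplicative_of_double (G := fun x => lorentzFactor (f (p i x)).1)
      (fun x _ => one_le_lorentzFactor (norm_lt _)) ?_ ?_ ?_
      (one_le_lorentzFactor (norm_lt u))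
    · intro x y hx hy
      obtain ⟨hx1, c, hc⟩ := hp i x hx
      obtain ⟨hy1, d, hd⟩ := hp j y hy
      have h0 : inner ℝ (p i x).1 (p j y).1 = 0 := by
        rw [hc, hd, inner_smul_left, inner_smul_right]
        simp [EuclideanSpace.inner_single_left, hij]
      have h1 := hf.lorentzFactor_map_einsteinAdd (p i x) (p j y)
      rw [hf.inner_map_eq_zero hn h0, hG, hG (p j y), hy1, einsteinAdd,
        lorentzFactor_velocityAdd (norm_lt _) (norm_lt _), h0, hx1, hy1] at h1
      simpa using h1
    · intro x hx
      obtain ⟨hx1, -⟩ := hp i x hx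
      have h1 := hf.lorentzFactor_map_einsteinAdd (p i x) (p i x)
      have h2 := lorentzFactor_sq_mul (norm_lt (p i x))
      have h3 := lorentzFactor_sq_mul (norm_lt (f (p i x)))
      rw [hx1] at h2
      rw [hG, einsteinAdd, lorentzFactor_velocityAdd (norm_lt _) (norm_lt _), hx1,
        real_inner_self_eq_norm_sq, real_inner_self_eq_norm_sq,
        show x * x * (1 + ‖(p i x).1‖ ^ 2) = 2 * x ^ 2 - 1 by linarith] at h1
      simp only [h1]
      linarith
    · by_contra! h
      obtain ⟨h2, c, hc⟩ := hp i 2 one_le_two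
      obtain ⟨h1, -⟩ := hp i 1 le_rfl
      have h3 (x : ℝ) (hx : 1 ≤ x) : (f (p i x)).1 = 0 := by
        have := lorentzFactor_sq_mul (norm_lt (f (p i x)))
        rw [h x hx] at this
        exact norm_eq_zero.1 (pow_eq_zero_iff two_ne_zero |>.1 (by linarith))
      have h4 := hinj (Subtype.ext ((h3 1 le_rfl).trans (h3 2 one_le_two).symm))
      rw [h4, h2] at h1
      norm_num at h1
  exact norm_eq_of_lorentzFactor_eq (norm_lt _) (norm_lt _) ((hG u).trans key)

theorem inner_map_map (hn : 2 ≤ n) (hf : IsEinsteinEndomorphism f) (hinj : Function.Injective f)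
    (u v : EinsteinBall n) : inner ℝ (f u).1 (f v).1 = inner ℝ u.1 v.1 := by
  have hγ (w : EinsteinBall n) : lorentzFactor (f w).1 = lorentzFactor w.1 := by
    rw [lorentzFactor, lorentzFactor, hf.norm_map hn hinj]
  have h := hf.lorentzFactor_map_einsteinAdd u v
  rw [hγ, hγ, hγ, einsteinAdd, lorentzFactor_velocityAdd (norm_lt _) (norm_lt _)] at h
  have h5 := mul_left_cancel₀ (mul_pos (lorentzFactor_pos (norm_lt u))
    (lorentzFactor_pos (norm_lt v))).ne' h
  linarith

end IsEinsteinEndomorphism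

/-! ### Orthogonal transformations and the conclusion. -/

/-- A self-map of the unit ball preserving inner products is the restriction of an orthogonal
transformation. -/
theorem exists_orthogonalRestrict_eq {n : ℕ} {f : EinsteinBall n → EinsteinBall n}
    (h : ∀ u v, inner ℝ (f u).1 (f v).1 = inner ℝ u.1 v.1) :
    ∃ A, orthogonalRestrict A = f := by
  -- Unit vectors lie outside the open ball, so the basis vectors are halved and their images
  -- doubled.
  have hmem (i : Fin n) : (2⁻¹ : ℝ) • EuclideanSpace.single i (1 : ℝ) ∈
      Metric.ball (0 : EuclideanSpace ℝ (Fin n)) 1 := by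
    rw [mem_ball_zero_iff, norm_smul]
    norm_num
  have horth : Orthonormal ℝ (fun i : Fin n => (2 : ℝ) • (f ⟨_, hmem i⟩).1) := by
    rw [orthonormal_iff_ite]
    intro i j
    rw [inner_smul_left, inner_smul_right, h, inner_smul_left, inner_smul_right,
      EuclideanSpace.inner_single_left]
    by_cases hij : i = j <;> simp [hij]
  have hspan : ⊤ ≤ Submodule.span ℝ (Set.range fun i : Fin n => (2 : ℝ) • (f ⟨_, hmem i⟩).1) :=
    (horth.linearIndependent.span_eq_top_of_card_eq_finrank' (by simp)).ge
  refine ⟨(OrthonormalBasis.mk horth hspan).repr.symm, funext fun u => Subtype.ext ?_⟩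
  change (OrthonormalBasis.mk horth hspan).repr.symm u.1 = (f u).1
  rw [LinearIsometryEquiv.symm_apply_eq]
  ext i
  rw [OrthonormalBasis.repr_apply_apply, OrthonormalBasis.coe_mk, inner_smul_left, h,
    inner_smul_left, EuclideanSpace.inner_single_left]
  simp

theorem isEinsteinAutomorphism_orthogonalRestrict {n : ℕ}
    (A : EuclideanSpace ℝ (Fin n) ≃ₗᵢ[ℝ] EuclideanSpace ℝ (Fin n)) :
    IsEinsteinAutomorphism (orthogonalRestrict A) := by
  refine ⟨fun u v => Subtype.ext ?_, fun u v huv => Subtype.ext ?_, fun v => ?_⟩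
  · simp [orthogonalRestrict, einsteinAdd, velocityAdd]
  · exact A.injective (congrArg Subtype.val huv)
  · exact ⟨orthogonalRestrict A.symm v, Subtype.ext (A.apply_symm_apply v.1)⟩

theorem theorem2p1 (n : ℕ) (hn : 2 ≤ n) :
    {f : EinsteinBall n → EinsteinBall n | IsEinsteinAutomorphism f} =
      Set.range (fun A : EuclideanSpace ℝ (Fin n) ≃ₗᵢ[ℝ] EuclideanSpace ℝ (Fin n) =>
        orthogonalRestrict A) := by
  ext f
  constructor
  · rintro ⟨hf, hbij⟩
    exact exists_orthogonalRestrict_eq (hf.inner_map_map hn hbij.injective)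
  · rintro ⟨A, rfl⟩
    exact isEinsteinAutomorphism_orthogonalRestrict A
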